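/- **Theorem 6.5.** A *circle* in the Riemann sphere $\hat{\mathbb C}$ is a Euclidean circle or a line together with $\infty$, with a choice of one of its two complementary open discs as *interior*; the other one is its *exterior*. Suppose that $A,B$ are Möbius transformations for which there are circles $C_1,C_1',C_2,C_2'$ in $\hat{\mathbb C}$ with pairwise disjoint interiors (tangencies are allowed) such that $A$ maps the exterior of $C_1$ onto the interior of $C_1'$ and $B$ maps the exterior of $C_2$ onto the interior of $C_2'$; let $G=\langle A,B\rangle$ (that is, $G$ is a marked classical T-Schottky group on the generators $A,B$). Suppose that $G$ is also generated by two parabolic elements $S$ and $T$. Then there are a pair $(A',B')$ obtained from $(A,B)$ by possibly interchanging the two entries and possibly replacing entries by their inverses, a pair $(S',T')$ obtained from $(S,T)$ in the same way, and an element $h\in G$ such that $$hS'h^{-1}=A' \quad\text{and}\quad \bigl(hT'h^{-1}=B' \ \text{ or } \ hT'h^{-1}=A'B'\bigr).$$ -/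

import Mathlib

/-- The group of Möbius transformations of the Riemann sphere `OnePoint ℂ`: those permutations of
the sphere which are induced by some invertible complex `2 × 2` matrix. It is isomorphic to
`PSL(2, ℂ)`, and its elements are transformations, not matrices. -/
abbrev Mobius : Type :=
  (MulAction.toPermHom (Matrix.GeneralLinearGroup (Fin 2) ℂ) (OnePoint ℂ)).range

/-- A Möbius transformation is parabolic if it is induced by a parabolic matrix, i.e. by a
non-scalar matrix whose characteristic polynomial has discriminant `tr² - 4 det` equal to `0`. -/
def Mobius.IsParabolic (f : Mobius) : Prop :=
  ∃ M : Matrix.GeneralLinearGroup (Fin 2) ℂ,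
    M.IsParabolic ∧ ∀ z : OnePoint ℂ, f • z = M • z

/-- A circle in the Riemann sphere (a Euclidean circle, or a line together with `∞`) with a choice
of which of its two sides is called the interior. It is the zero set of
`a |z|² + 2 Re (conj b * z) + c`, where `a c < |b|²`; the interior is the side where this
expression is negative. -/
structure OrientedCircle where
  a : ℝ
  b : ℂ
  c : ℝ
  nondegenerate : a * c < Complex.normSq b

namespace OrientedCircle

/-- The expression `a |z|² + 2 Re (conj b * z) + c`; at `∞` its sign is that of the coefficient
of the leading term `|z|²`. -/
def form (C : OrientedCircle) (z : OnePoint ℂ) : ℝ :=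
  z.elim C.a fun w ↦ C.a * Complex.normSq w + 2 * ((starRingEnd ℂ) C.b * w).re + C.c

/-- The interior of an oriented circle: an open disc in the Riemann sphere. -/
def interior (C : OrientedCircle) : Set (OnePoint ℂ) := {z | C.form z < 0}

/-- The exterior of an oriented circle: the complementary open disc in the Riemann sphere. -/
def exterior (C : OrientedCircle) : Set (OnePoint ℂ) := {z | 0 < C.form z}

end OrientedCircle

/-- The circles `C i`, `C' i` with the side pairings `g i` form a classical T-Schottky
configuration: the interiors of the `2n` circles are pairwise disjoint (the circles may be
tangent), and `g i` maps the exterior of `C i` onto the interior of `C' i`. -/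
structure IsClassicalTSchottkyConfiguration {n : ℕ} (C C' : Fin n → OrientedCircle)
    (g : Fin n → Mobius) : Prop where
  disjoint_interiors :
    Pairwise fun i j : Fin n ⊕ Fin n ↦
      Disjoint (Sum.elim C C' i).interior (Sum.elim C C' j).interior
  image_exterior : ∀ i, (fun z ↦ g i • z) '' (C i).exterior = (C' i).interior

/-- `G` is a marked classical T-Schottky group on the generators `g 0, …, g (n - 1)`. -/
structure IsMarkedClassicalTSchottky {n : ℕ} (G : Subgroup Mobius) (g : Fin n → Mobius) :
    Prop where
  generates : Subgroup.closure (Set.range g) = G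
  exists_configuration :
    ∃ C C' : Fin n → OrientedCircle, IsClassicalTSchottkyConfiguration C C' g

/-- The pair `q` arises from the pair `p` by (possibly) interchanging the two entries and
(possibly) replacing either entry by its inverse. -/
def IsSwapInvOf {Γ : Type*} [Group Γ] (p q : Γ × Γ) : Prop :=
  ∃ x y : Γ, (x = p.1 ∨ x = p.1⁻¹) ∧ (y = p.2 ∨ y = p.2⁻¹) ∧ (q = (x, y) ∨ q = (y, x))

/-!
By the ping-pong argument `G` is free on `A`, `B`, and its elements can be read as reduced words.
If the word of a parabolic element starts with the letter `x`, while the word of its inverse starts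
with a different letter `y`, then its fixed point lies in the closed discs of `x` and of `y`, that
is, it is the point of tangency of their circles. Two parabolic elements with the same pair `x`, `y`
have the same fixed point and commute; as noncommuting generators of `G`, `S` and `T` therefore
never share such a turn, even after simultaneous conjugation: in the Cayley tree, their axes have no
two consecutive edges in common.

The rest is combinatorics in the free group of rank two. Conjugate by a common first letter as long
as this shortens the words. If finally `S`, `S⁻¹` share no first letter with `T`, `T⁻¹`, a Nielsen
type cancellation argument shows that `S` and `T` are the free generators, up to order and inverses.
If, after inversions, `S` and `T` have a common first letter `x`, then their axes branch at both of
its ends, and the same argument forces one of the words to be the single letter `x` and the other to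
be `x` times the other generator.
-/

/-! ### Homogeneous coordinates and oriented circles -/

/-- `v` is a vector of homogeneous coordinates for the point `z` of the projective line. -/
def IsHomogeneousCoord {K : Type*} [Field K] [DecidableEq K] (v : Fin 2 → K) (z : OnePoint K) :
    Prop :=
  ∃ hv : v ≠ 0, Projectivization.mk K v hv = OnePoint.equivProjectivization K z

namespace IsHomogeneousCoord

variable {K : Type*} [Field K] [DecidableEq K] {v w : Fin 2 → K} {z y : OnePoint K}

lemma infty : IsHomogeneousCoord ![1, 0] (OnePoint.infty : OnePoint K) := ⟨_, rfl⟩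

lemma coe (t : K) : IsHomogeneousCoord ![t, 1] (t : OnePoint K) := ⟨_, rfl⟩

lemma exists_left (z : OnePoint K) : ∃ v, IsHomogeneousCoord v z :=
  ⟨_, Projectivization.rep_nonzero _, Projectivization.mk_rep _⟩

lemma exists_right (hv : v ≠ 0) : ∃ z, IsHomogeneousCoord v z :=
  ⟨_, hv, ((OnePoint.equivProjectivization K).apply_symm_apply _).symm⟩

lemma ne_zero (h : IsHomogeneousCoord v z) : v ≠ 0 := h.1

lemma eq_iff (hv : IsHomogeneousCoord v z) (hw : IsHomogeneousCoord w y) :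
    z = y ↔ ∃ c : K, c • w = v := by
  obtain ⟨hv0, hv⟩ := hv
  obtain ⟨hw0, hw⟩ := hw
  rw [← (OnePoint.equivProjectivization K).apply_eq_iff_eq, ← hv, ← hw,
    Projectivization.mk_eq_mk_iff']

lemma unique (hz : IsHomogeneousCoord v z) (hy : IsHomogeneousCoord v y) : z = y :=
  (eq_iff hz hy).2 ⟨1, one_smul K v⟩

lemma smul (h : IsHomogeneousCoord v z) {c : K} (hc : c ≠ 0) : IsHomogeneousCoord (c • v) z := by
  obtain ⟨hv, h⟩ := h
  exact ⟨smul_ne_zero hc hv, h ▸ (Projectivization.mk_eq_mk_iff' K _ _ _ _).2 ⟨c, rfl⟩⟩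

lemma mulVec (h : IsHomogeneousCoord v z) (M : Matrix.GeneralLinearGroup (Fin 2) K) :
    IsHomogeneousCoord (M.1.mulVec v) (M • z) := by
  obtain ⟨hv, h⟩ := h
  exact ⟨(smul_ne_zero_iff_ne M).2 hv, by
    rw [OnePoint.equivProjectivization_smul, ← h, Projectivization.smul_mk]; rfl⟩

lemma exists_eq_add_smul (hv : IsHomogeneousCoord v z) (hw : IsHomogeneousCoord w y)
    (hzy : z ≠ y) (u : Fin 2 → K) : ∃ s t : K, s • v + t • w = u := by
  have hli : LinearIndependent K ![w, v] := by
    rw [LinearIndependent.pair_iff' hw.ne_zero]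
    exact fun c hc ↦ hzy ((hv.eq_iff hw).2 ⟨c, hc⟩)
  have hspan : Submodule.span K (Set.range ![w, v]) = ⊤ :=
    hli.span_eq_top_of_card_eq_finrank (by simp)
  rw [Matrix.range_cons_cons_empty, Set.pair_comm] at hspan
  exact Submodule.mem_span_pair.1 (hspan ▸ Submodule.mem_top)

end IsHomogeneousCoord

lemma Mobius.exists_matrix (f : Mobius) :
    ∃ M : Matrix.GeneralLinearGroup (Fin 2) ℂ, ∀ z : OnePoint ℂ, f • z = M • z := by
  obtain ⟨f, M, rfl⟩ := f
  exact ⟨M, fun z ↦ rfl⟩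

section QuadraticMap

lemma quadraticMap_parallelogram {R M N : Type*} [CommRing R] [AddCommGroup M] [AddCommGroup N]
    [Module R M] [Module R N] (Q : QuadraticMap R M N) (v w : M) :
    Q (v + w) + Q (v - w) = 2 • (Q v + Q w) := by
  have h := Q.polar_neg_right v w
  simp only [QuadraticMap.polar, QuadraticMap.map_neg, ← sub_eq_add_neg] at h
  rw [sub_sub, sub_sub, sub_eq_iff_eq_add] at h
  rw [h]
  abel

variable {E : Type*} [AddCommGroup E] [Module ℝ E] [TopologicalSpace E] [ContinuousAdd E]
  [ContinuousSMul ℝ E]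

-- At a zero of `Q` in the interior, the parallelogram law would give
-- `0 ≤ Q (v + t • u) + Q (v - t • u) = 2 * t ^ 2 * Q u < 0` for small `t ≠ 0`.
lemma interior_setOf_quadraticForm_nonneg {Q : QuadraticForm ℝ E} (hQ : Continuous Q) {u : E}
    (hu : Q u < 0) : interior {v | 0 ≤ Q v} = {v | 0 < Q v} := by
  refine subset_antisymm (fun v hv ↦ ?_)
    (interior_maximal (fun v (hv : 0 < Q v) ↦ hv.le) (isOpen_lt continuous_const hQ))
  have hnonneg {w : E} (hw : w ∈ interior {v | 0 ≤ Q v}) : 0 ≤ Q w :=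
    interior_subset (s := {v | 0 ≤ Q v}) hw
  refine lt_of_le_of_ne (hnonneg hv) fun h0 ↦ ?_
  have hlim (ε : ℝ) : Filter.Tendsto (fun t : ℝ ↦ v + (ε * t) • u) (nhds 0) (nhds v) :=
    Continuous.tendsto' (by fun_prop) _ _ (by simp)
  have hev (ε : ℝ) := (hlim ε).eventually (isOpen_interior.mem_nhds hv)
  obtain ⟨t, ⟨ht₁, ht₂⟩, ht⟩ := ((((hev 1).and (hev (-1))).filter_mono
    nhdsWithin_le_nhds).and (self_mem_nhdsWithin (s := {0}ᶜ))).exists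
  rw [one_mul] at ht₁
  rw [neg_one_mul, neg_smul, ← sub_eq_add_neg] at ht₂
  have h := quadraticMap_parallelogram Q v (t • u)
  rw [QuadraticMap.map_smul, ← h0, zero_add, nsmul_eq_mul, smul_eq_mul, Nat.cast_ofNat] at h
  linarith [hnonneg ht₁, hnonneg ht₂, mul_neg_of_pos_of_neg (mul_self_pos.2 ht) hu]

end QuadraticMap

namespace OrientedCircle

variable {C C' : OrientedCircle} {v : Fin 2 → ℂ} {z : OnePoint ℂ}

/-- The Hermitian form `a |v₀|² + 2 Re (conj b * v₀ * conj v₁) + c |v₁|²`, the homogenization of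
`C.form`, as a real quadratic form: points and sides of the circle are read off its sign. -/
noncomputable def hermitianForm (C : OrientedCircle) : QuadraticForm ℝ (Fin 2 → ℂ) :=
  QuadraticMap.ofPolar
    (fun v ↦ C.a * Complex.normSq (v 0) +
      2 * ((starRingEnd ℂ) C.b * (v 0 * (starRingEnd ℂ) (v 1))).re + C.c * Complex.normSq (v 1))
    (fun t v ↦ by simp [Complex.normSq_apply]; ring)
    (fun v v' w ↦ by simp [QuadraticMap.polar, Complex.normSq_apply]; ring)
    (fun t v w ↦ by simp [QuadraticMap.polar, Complex.normSq_apply]; ring)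

lemma hermitianForm_apply (C : OrientedCircle) (v : Fin 2 → ℂ) :
    C.hermitianForm v = C.a * Complex.normSq (v 0) +
      2 * ((starRingEnd ℂ) C.b * (v 0 * (starRingEnd ℂ) (v 1))).re +
      C.c * Complex.normSq (v 1) := rfl

lemma continuous_hermitianForm (C : OrientedCircle) : Continuous C.hermitianForm := by
  have := Complex.continuous_normSq
  simp only [funext C.hermitianForm_apply]
  fun_prop

lemma hermitianForm_smul (C : OrientedCircle) (c : ℂ) (v : Fin 2 → ℂ) :
    C.hermitianForm (c • v) = Complex.normSq c * C.hermitianForm v := by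
  simp only [hermitianForm_apply, Complex.normSq_apply, Pi.smul_apply, smul_eq_mul,
    Complex.mul_re, Complex.mul_im, Complex.conj_re, Complex.conj_im]
  ring

lemma exists_hermitianForm_eq_mul_form (C : OrientedCircle) (h : IsHomogeneousCoord v z) :
    ∃ r : ℝ, 0 < r ∧ C.hermitianForm v = r * C.form z := by
  obtain ⟨w, hw, e⟩ : ∃ w, IsHomogeneousCoord w z ∧ C.hermitianForm w = C.form z := by
    cases z with
    | infty => exact ⟨_, .infty, by simp [hermitianForm_apply, form]⟩
    | coe t => exact ⟨_, .coe t, by simp [hermitianForm_apply, form]⟩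
  obtain ⟨c, rfl⟩ := (h.eq_iff hw).1 rfl
  have hc : c ≠ 0 := by
    rintro rfl
    exact h.ne_zero (zero_smul ℂ w)
  exact ⟨_, Complex.normSq_pos.2 hc, by rw [hermitianForm_smul, e]⟩

lemma mem_interior_iff (h : IsHomogeneousCoord v z) :
    z ∈ C.interior ↔ C.hermitianForm v < 0 := by
  obtain ⟨r, hr, e⟩ := C.exists_hermitianForm_eq_mul_form h
  rw [e, ← smul_eq_mul, smul_neg_iff_of_pos_left hr]
  rfl

lemma mem_exterior_iff (h : IsHomogeneousCoord v z) :
    z ∈ C.exterior ↔ 0 < C.hermitianForm v := by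
  obtain ⟨r, hr, e⟩ := C.exists_hermitianForm_eq_mul_form h
  rw [e, mul_pos_iff_of_pos_left hr]
  rfl

lemma notMem_exterior_iff (h : IsHomogeneousCoord v z) :
    z ∉ C.exterior ↔ C.hermitianForm v ≤ 0 := by
  rw [mem_exterior_iff h, not_lt]

lemma notMem_exterior_of_mem_interior (h : z ∈ C.interior) : z ∉ C.exterior :=
  lt_asymm (a := C.form z) (b := 0) h

lemma exists_hermitianForm_neg (C : OrientedCircle) : ∃ v, C.hermitianForm v < 0 := by
  have hC := C.nondegenerate
  rcases lt_trichotomy C.a 0 with h | h | h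
  · exact ⟨![1, 0], by simpa [hermitianForm_apply] using h⟩
  · have hb : 0 < Complex.normSq C.b := by simpa [h] using hC
    refine ⟨![-(|C.c| + 1 : ℝ) * C.b, Complex.normSq C.b], ?_⟩
    have e : C.hermitianForm ![-(|C.c| + 1 : ℝ) * C.b, Complex.normSq C.b] =
        Complex.normSq C.b ^ 2 * (C.c - 2 * |C.c| - 2) := by
      simp [hermitianForm_apply, Complex.normSq_apply, h]
      ring
    rw [e]
    exact mul_neg_of_pos_of_neg (pow_pos hb 2) (by linarith [le_abs_self C.c, abs_nonneg C.c])
  · refine ⟨![-C.b, C.a], ?_⟩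
    have e : C.hermitianForm ![-C.b, C.a] = C.a * (C.a * C.c - Complex.normSq C.b) := by
      simp [hermitianForm_apply, Complex.normSq_apply]
      ring
    rw [e]
    exact mul_neg_of_pos_of_neg h (sub_neg.2 hC)

lemma exists_isHomogeneousCoord_mem_interior (h : C.hermitianForm v < 0) :
    ∃ z ∈ C.interior, IsHomogeneousCoord v z := by
  obtain ⟨z, hz⟩ := IsHomogeneousCoord.exists_right (K := ℂ) (v := v) (by rintro rfl; simp at h)
  exact ⟨z, (mem_interior_iff hz).2 h, hz⟩

lemma interior_nonempty (C : OrientedCircle) : C.interior.Nonempty := by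
  obtain ⟨v, hv⟩ := C.exists_hermitianForm_neg
  obtain ⟨z, hz, -⟩ := exists_isHomogeneousCoord_mem_interior hv
  exact ⟨z, hz⟩

lemma interior_hermitianForm_nonneg (C : OrientedCircle) :
    _root_.interior {v | 0 ≤ C.hermitianForm v} = {v | 0 < C.hermitianForm v} := by
  obtain ⟨u, hu⟩ := C.exists_hermitianForm_neg
  exact interior_setOf_quadraticForm_nonneg C.continuous_hermitianForm hu

lemma interior_subset_exterior (h : Disjoint C.interior C'.interior) :
    C'.interior ⊆ C.exterior := by
  have hsub : {v | C'.hermitianForm v < 0} ⊆ {v | 0 ≤ C.hermitianForm v} := by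
    intro v hv
    obtain ⟨z, hz, hvz⟩ := exists_isHomogeneousCoord_mem_interior hv
    exact not_lt.1 fun hneg ↦ Set.disjoint_left.1 h ((mem_interior_iff hvz).2 hneg) hz
  intro z hz
  obtain ⟨v, hv⟩ := IsHomogeneousCoord.exists_left z
  rw [mem_exterior_iff hv]
  exact C.interior_hermitianForm_nonneg.subset <| interior_maximal hsub
    (isOpen_lt C'.continuous_hermitianForm continuous_const) ((mem_interior_iff hv).1 hz)

lemma hermitianForm_eq_zero (h : Disjoint C.interior C'.interior) (hz : z ∉ C.exterior)
    (hz' : z ∉ C'.exterior) (hv : IsHomogeneousCoord v z) : C.hermitianForm v = 0 :=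
  le_antisymm ((notMem_exterior_iff hv).1 hz) <| not_lt.1 fun hneg ↦
    hz' (interior_subset_exterior h.symm ((mem_interior_iff hv).2 hneg))

-- If both discs touched at `p ≠ q`, write coordinates of a point of the third disc as `v + w` with
-- `v`, `w` over `p`, `q`: by the parallelogram law `v - w` would lie inside both discs.
lemma eq_of_notMem_exterior {C₁ C₂ C₃ : OrientedCircle}
    (h₁₂ : Disjoint C₁.interior C₂.interior) (h₁₃ : Disjoint C₁.interior C₃.interior)
    (h₂₃ : Disjoint C₂.interior C₃.interior) {p q : OnePoint ℂ} (hp₁ : p ∉ C₁.exterior)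
    (hp₂ : p ∉ C₂.exterior) (hq₁ : q ∉ C₁.exterior) (hq₂ : q ∉ C₂.exterior) : p = q := by
  by_contra hpq
  obtain ⟨v, hv⟩ := IsHomogeneousCoord.exists_left p
  obtain ⟨w, hw⟩ := IsHomogeneousCoord.exists_left q
  obtain ⟨x, hx⟩ := C₃.interior_nonempty
  obtain ⟨u, hu⟩ := IsHomogeneousCoord.exists_left x
  obtain ⟨s, t, rfl⟩ := hv.exists_eq_add_smul hw hpq u
  have neg {C C' : OrientedCircle} (h : Disjoint C.interior C'.interior)
      (h₃ : Disjoint C.interior C₃.interior) (hp : p ∉ C.exterior) (hp' : p ∉ C'.exterior)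
      (hq : q ∉ C.exterior) (hq' : q ∉ C'.exterior) :
      C.hermitianForm (s • v - t • w) < 0 := by
    have e := quadraticMap_parallelogram C.hermitianForm (s • v) (t • w)
    rw [hermitianForm_smul, hermitianForm_smul, hermitianForm_eq_zero h hp hp' hv,
      hermitianForm_eq_zero h hq hq' hw, mul_zero, mul_zero, add_zero, smul_zero] at e
    linarith [(mem_exterior_iff hu).1 (interior_subset_exterior h₃ hx)]
  have h₁ := neg h₁₂ h₁₃ hp₁ hp₂ hq₁ hq₂
  have h₂ := neg h₁₂.symm h₂₃ hp₂ hp₁ hq₂ hq₁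
  obtain ⟨y, hy, hvwy⟩ := exists_isHomogeneousCoord_mem_interior h₁
  exact Set.disjoint_left.1 h₁₂ hy ((mem_interior_iff hvwy).2 h₂)

lemma smul_mem_interior_iff {f : Mobius} (h : (fun z ↦ f • z) '' C.exterior = C'.interior) :
    f • z ∈ C'.interior ↔ z ∈ C.exterior := by
  rw [← h]
  exact (MulAction.injective f).mem_set_image

lemma smul_mem_exterior_iff {f : Mobius} (h : (fun z ↦ f • z) '' C.exterior = C'.interior) :
    f • z ∈ C'.exterior ↔ z ∈ C.interior := by
  obtain ⟨M, hM⟩ := f.exists_matrix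
  set R := C'.hermitianForm.comp ((Matrix.toLin' M.1).restrictScalars ℝ)
  have hcoord {v z} (hv : IsHomogeneousCoord v z) : IsHomogeneousCoord (M.1.mulVec v) (f • z) :=
    hM z ▸ hv.mulVec M
  have hRC (v) : R v < 0 ↔ -C.hermitianForm v < 0 := by
    rw [neg_lt_zero]
    by_cases hv0 : v = 0
    · simp [hv0]
    · obtain ⟨y, hv⟩ := IsHomogeneousCoord.exists_right hv0
      exact (mem_interior_iff (hcoord hv)).symm.trans <|
        (smul_mem_interior_iff h).trans (mem_exterior_iff hv)
  obtain ⟨y, hy⟩ := C'.interior_nonempty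
  obtain ⟨x, hx, rfl⟩ := h.symm ▸ hy
  obtain ⟨u, hu⟩ := IsHomogeneousCoord.exists_left x
  have hu0 : (-C.hermitianForm) u < 0 := neg_lt_zero.2 ((mem_exterior_iff hu).1 hx)
  have hR : Continuous R := C'.continuous_hermitianForm.comp (by fun_prop)
  have hpos : {v | 0 < R v} = {v | 0 < -C.hermitianForm v} := by
    rw [← interior_setOf_quadraticForm_nonneg hR ((hRC u).2 hu0)]
    refine Eq.trans ?_ (interior_setOf_quadraticForm_nonneg C.continuous_hermitianForm.neg hu0)
    congr 1
    exact Set.ext fun v ↦ not_iff_not.1 (by simpa using hRC v)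
  obtain ⟨v, hv⟩ := IsHomogeneousCoord.exists_left z
  rw [mem_exterior_iff (hcoord hv), mem_interior_iff hv, ← neg_pos]
  exact Set.ext_iff.1 hpos v

end OrientedCircle

/-! ### Parabolic Möbius transformations -/

lemma isParabolic_inv {R : Type*} [CommRing R] {M : Matrix.GeneralLinearGroup (Fin 2) R}
    (hM : M.IsParabolic) : (M⁻¹).IsParabolic := by
  refine ⟨fun h ↦ hM.1 ?_, ?_⟩
  · rw [Matrix.mem_range_scalar_iff_commute_single'] at h ⊢
    simpa only [Commute.units_inv_right_iff] using h
  · have h := hM.2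
    rw [Matrix.discr_fin_two, Matrix.trace_fin_two, Matrix.det_fin_two] at h ⊢
    rw [Matrix.coe_units_inv, Matrix.inv_def, Matrix.adjugate_fin_two]
    simp only [Matrix.smul_apply, Matrix.of_apply, Matrix.cons_val', Matrix.cons_val_zero,
      Matrix.cons_val_one, Matrix.cons_val_fin_one, smul_eq_mul]
    linear_combination Ring.inverse M.1.det ^ 2 * h

section NilpotentMatrix

variable {K : Type*} [Field K] [DecidableEq K] {m n : Matrix (Fin 2) (Fin 2) K}
  {u v w : Fin 2 → K} {p q z : OnePoint K}

lemma eq_of_mulVec_eq_zero (hn : n ≠ 0) (hv : IsHomogeneousCoord v p)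
    (hw : IsHomogeneousCoord w q) (hnv : n.mulVec v = 0) (hnw : n.mulVec w = 0) : p = q := by
  by_contra hpq
  refine hn (Matrix.ext_of_mulVec_single fun i ↦ ?_)
  obtain ⟨s, t, h⟩ := hv.exists_eq_add_smul hw hpq (Pi.single i 1)
  simp only [← h, Matrix.mulVec_add, Matrix.mulVec_smul, hnv, hnw, smul_zero, add_zero,
    Matrix.zero_mulVec]

lemma isHomogeneousCoord_mulVec_of_mul_self_eq_zero (hn2 : n * n = 0)
    (hv : IsHomogeneousCoord v p) (hnv : n.mulVec v = 0) (hnu : n.mulVec u ≠ 0) :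
    IsHomogeneousCoord (n.mulVec u) p := by
  obtain ⟨q, hq⟩ := IsHomogeneousCoord.exists_right hnu
  have hn : n ≠ 0 := by
    rintro rfl
    exact hnu (Matrix.zero_mulVec u)
  have hnn : n.mulVec (n.mulVec u) = 0 := by rw [Matrix.mulVec_mulVec, hn2, Matrix.zero_mulVec]
  exact eq_of_mulVec_eq_zero hn hv hq hnv hnn ▸ hq

lemma mul_eq_zero_of_mulVec_eq_zero (hm2 : m * m = 0) (hv : IsHomogeneousCoord v p)
    (hnv : n.mulVec v = 0) (hmv : m.mulVec v = 0) : n * m = 0 := by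
  refine Matrix.ext_of_mulVec_single fun i ↦ ?_
  rw [← Matrix.mulVec_mulVec, Matrix.zero_mulVec]
  by_cases h0 : m.mulVec (Pi.single i 1) = 0
  · rw [h0, Matrix.mulVec_zero]
  · obtain ⟨c, hc⟩ :=
      ((isHomogeneousCoord_mulVec_of_mul_self_eq_zero hm2 hv hmv h0).eq_iff hv).1 rfl
    rw [← hc, Matrix.mulVec_smul, hnv, smul_zero]

lemma one_add_pow_of_mul_self_eq_zero {R : Type*} [Semiring R] {a : R} (h : a * a = 0) (k : ℕ) :
    (1 + a) ^ k = 1 + k • a := by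
  induction k with
  | zero => simp
  | succ k ih =>
    rw [pow_succ, ih, mul_add, mul_one, add_mul, one_mul, smul_mul_assoc, h, smul_zero, add_zero,
      succ_nsmul, add_assoc]

end NilpotentMatrix

namespace Mobius

variable {f g : Mobius} {p z : OnePoint ℂ}

/-- The matrix `M` induces the Möbius transformation `f`. -/
def IsInducedBy (f : Mobius) (M : Matrix (Fin 2) (Fin 2) ℂ) : Prop :=
  ∀ ⦃v : Fin 2 → ℂ⦄ ⦃z : OnePoint ℂ⦄, IsHomogeneousCoord v z →
    IsHomogeneousCoord (M.mulVec v) (f • z)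

namespace IsInducedBy

variable {M N n : Matrix (Fin 2) (Fin 2) ℂ} {v : Fin 2 → ℂ}

lemma of_smul_eq {M : Matrix.GeneralLinearGroup (Fin 2) ℂ}
    (h : ∀ z : OnePoint ℂ, f • z = M • z) : f.IsInducedBy M :=
  fun _ z hv ↦ h z ▸ hv.mulVec M

lemma one : (1 : Mobius).IsInducedBy 1 := fun v z hv ↦ by
  rwa [Matrix.one_mulVec, one_smul]

lemma mul (hf : f.IsInducedBy M) (hg : g.IsInducedBy N) : (f * g).IsInducedBy (M * N) :=
  fun v z hv ↦ by
    rw [← Matrix.mulVec_mulVec, mul_smul]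
    exact hf (hg hv)

lemma pow (hf : f.IsInducedBy M) : ∀ k : ℕ, (f ^ k).IsInducedBy (M ^ k)
  | 0 => by simpa only [pow_zero] using one
  | k + 1 => by simpa only [pow_succ] using (hf.pow k).mul hf

lemma smul (hf : f.IsInducedBy M) {c : ℂ} (hc : c ≠ 0) : f.IsInducedBy (c • M) :=
  fun v z hv ↦ by
    rw [Matrix.smul_mulVec]
    exact (hf hv).smul hc

lemma unique (hf : f.IsInducedBy M) (hg : g.IsInducedBy M) : f = g :=
  Subtype.ext <| Equiv.ext fun z ↦ by
    obtain ⟨v, hv⟩ := IsHomogeneousCoord.exists_left z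
    exact (hf hv).unique (hg hv)

lemma mulVec_eq_zero (hf : f.IsInducedBy (1 + n)) (hn2 : n * n = 0) (hp : f • p = p)
    (hv : IsHomogeneousCoord v p) : n.mulVec v = 0 := by
  obtain ⟨c, hc⟩ := ((hf hv).eq_iff hv).1 hp
  have hnv : n.mulVec v = (c - 1) • v := by
    rw [sub_smul, hc, one_smul, Matrix.add_mulVec, Matrix.one_mulVec, add_sub_cancel_left]
  have hc2 : ((c - 1) * (c - 1)) • v = 0 := by
    rw [mul_smul, ← hnv, ← Matrix.mulVec_smul, ← hnv, Matrix.mulVec_mulVec, hn2,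
      Matrix.zero_mulVec]
  rw [hnv, mul_self_eq_zero.1 ((smul_eq_zero_iff_left hv.ne_zero).1 hc2), zero_smul]

end IsInducedBy

namespace IsParabolic

lemma exists_isInducedBy (hf : f.IsParabolic) :
    ∃ n : Matrix (Fin 2) (Fin 2) ℂ, n ≠ 0 ∧ n * n = 0 ∧ f.IsInducedBy (1 + n) := by
  obtain ⟨M, hM, hfM⟩ := hf
  obtain ⟨a, n, hMan, hn, hn2⟩ := Matrix.isParabolic_iff_exists.1 hM
  rw [pow_two] at hn2
  have ha : a ≠ 0 := by
    rintro rfl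
    rw [map_zero, zero_add] at hMan
    refine M.det_ne_zero (mul_self_eq_zero.1 ?_)
    rw [hMan, ← Matrix.det_mul, hn2, Matrix.det_zero]
  refine ⟨a⁻¹ • n, smul_ne_zero (inv_ne_zero ha) hn, by rw [smul_mul_smul_comm, hn2, smul_zero], ?_⟩
  have hsmul : a⁻¹ • M.1 = 1 + a⁻¹ • n := by
    rw [hMan, smul_add, Matrix.scalar_apply, ← Matrix.smul_one_eq_diagonal, inv_smul_smul₀ ha]
  exact hsmul ▸ (IsInducedBy.of_smul_eq hfM).smul (inv_ne_zero ha)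

lemma exists_smul_eq_self (hf : f.IsParabolic) : ∃ p : OnePoint ℂ, f • p = p := by
  obtain ⟨M, hM, hfM⟩ := hf
  exact ⟨M.parabolicFixedPoint, by rw [hfM, hM.smul_eq_self_iff]⟩

lemma inv (hf : f.IsParabolic) : f⁻¹.IsParabolic := by
  obtain ⟨M, hM, hfM⟩ := hf
  exact ⟨M⁻¹, isParabolic_inv hM, fun z ↦ by rw [inv_smul_eq_iff, hfM, smul_inv_smul]⟩

lemma conj (hf : f.IsParabolic) (g : Mobius) : (g * f * g⁻¹).IsParabolic := by
  obtain ⟨M, hM, hfM⟩ := hf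
  obtain ⟨N, hN⟩ := g.exists_matrix
  have hNinv (z : OnePoint ℂ) : g⁻¹ • z = N⁻¹ • z := by
    rw [inv_smul_eq_iff, hN, smul_inv_smul]
  refine ⟨N * M * N⁻¹, by simpa using hM, fun z ↦ ?_⟩
  rw [mul_smul, mul_smul, mul_smul, mul_smul, hNinv, hfM, hN]

lemma commute (hf : f.IsParabolic) (hg : g.IsParabolic) (hfp : f • p = p) (hgp : g • p = p) :
    Commute f g := by
  obtain ⟨n, -, hn2, hfn⟩ := hf.exists_isInducedBy
  obtain ⟨m, -, hm2, hgm⟩ := hg.exists_isInducedBy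
  obtain ⟨v, hv⟩ := IsHomogeneousCoord.exists_left p
  have hnv := hfn.mulVec_eq_zero hn2 hfp hv
  have hmv := hgm.mulVec_eq_zero hm2 hgp hv
  have hnm : Commute n m := (mul_eq_zero_of_mulVec_eq_zero hm2 hv hnv hmv).trans
    (mul_eq_zero_of_mulVec_eq_zero hn2 hv hmv hnv).symm
  have hcomm : Commute (1 + n) (1 + m) :=
    .add_right (.one_right _) (.add_left (.one_left m) hnm)
  exact (hfn.mul hgm).unique (hcomm.eq ▸ hgm.mul hfn)

lemma notMem_exterior_of_forall_pow (hf : f.IsParabolic) (hp : f • p = p) {C : OrientedCircle}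
    (hz : ∀ k : ℕ, f ^ k • z ∉ C.exterior) : p ∉ C.exterior := by
  by_cases hzp : z = p
  · simpa [hzp] using hz 0
  obtain ⟨n, hn, hn2, hfn⟩ := hf.exists_isInducedBy
  obtain ⟨v, hv⟩ := IsHomogeneousCoord.exists_left p
  obtain ⟨u, hu⟩ := IsHomogeneousCoord.exists_left z
  have hnv := hfn.mulVec_eq_zero hn2 hp hv
  have hnu : n.mulVec u ≠ 0 := fun h ↦ hzp (eq_of_mulVec_eq_zero hn hu hv h hnv)
  rw [OrientedCircle.notMem_exterior_iff
    (isHomogeneousCoord_mulVec_of_mul_self_eq_zero hn2 hv hnv hnu)]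
  have horbit (k : ℕ) : C.hermitianForm (((k + 1 : ℕ) : ℂ)⁻¹ • u + n.mulVec u) ≤ 0 := by
    have hk : ((k + 1 : ℕ) : ℂ) ≠ 0 := Nat.cast_ne_zero.2 k.succ_ne_zero
    refine (OrientedCircle.notMem_exterior_iff ?_).1 (hz (k + 1))
    convert (hfn.pow (k + 1) hu).smul (inv_ne_zero hk) using 1
    rw [one_add_pow_of_mul_self_eq_zero hn2, ← Nat.cast_smul_eq_nsmul ℂ, Matrix.add_mulVec,
      Matrix.one_mulVec, Matrix.smul_mulVec, smul_add, inv_smul_smul₀ hk]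
  have hlim : Filter.Tendsto (fun k : ℕ ↦ ((k + 1 : ℕ) : ℂ)⁻¹ • u + n.mulVec u) Filter.atTop
      (nhds (n.mulVec u)) := by
    have h0 := (tendsto_inv_atTop_nhds_zero_nat (𝕜 := ℂ)).comp (Filter.tendsto_add_atTop_nat 1)
    simpa using (h0.smul_const u).add_const (n.mulVec u)
  exact le_of_tendsto' ((C.continuous_hermitianForm.tendsto _).comp hlim) horbit

end IsParabolic

end Mobius

/-! ### Reduced words and cancellation -/

open FreeGroup hiding map_one map_mul map_inv

section Words

variable {α : Type*}

/-- The inverse of the letter `x` of a free group, where `(a, true)` stands for the generator `a`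
and `(a, false)` for its inverse. -/
abbrev letterInv (x : α × Bool) : α × Bool := (x.1, !x.2)

lemma letterInv_ne (x : α × Bool) : letterInv x ≠ x := fun h ↦
  Bool.not_ne_self _ (congrArg Prod.snd h)

lemma ne_letterInv_iff {x y : α × Bool} : y ≠ letterInv x ↔ (x.1 = y.1 → x.2 = y.2) := by
  obtain ⟨x, b⟩ := x
  obtain ⟨y, c⟩ := y
  cases b <;> cases c <;> simp [eq_comm]

lemma isReduced_append_iff {L M : List (α × Bool)} :
    IsReduced (L ++ M) ↔ IsReduced L ∧ IsReduced M ∧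
      ∀ x ∈ L.getLast?, ∀ y ∈ M.head?, y ≠ letterInv x := by
  simp only [FreeGroup.IsReduced, List.isChain_append, ne_letterInv_iff]

lemma isReduced_cons_iff {x : α × Bool} {L : List (α × Bool)} :
    IsReduced (x :: L) ↔ IsReduced L ∧ letterInv x ∉ L.head? := by
  rw [← List.singleton_append, isReduced_append_iff]
  simp only [IsReduced.singleton, true_and, List.getLast?_singleton, Option.mem_some_iff,
    forall_eq']
  exact and_congr_right fun _ ↦ ⟨fun h hx ↦ h _ hx rfl, fun h y hy hyx ↦ h (hyx ▸ hy)⟩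

lemma head?_invRev (L : List (α × Bool)) : (invRev L).head? = L.getLast?.map letterInv := by
  simp [invRev]

lemma head?_eq_of_isPrefix {β : Type*} {L M : List β} (h : L <+: M) (hL : L ≠ []) :
    M.head? = L.head? := by
  obtain ⟨R, rfl⟩ := h
  exact List.head?_append_of_ne_nil L hL

lemma not_isPrefix_of_head?_ne {β : Type*} {L M : List β} (hL : L ≠ []) (h : L.head? ≠ M.head?) :
    ¬L <+: M :=
  fun hLM ↦ h (head?_eq_of_isPrefix hLM hL).symm

lemma inv_mk_singleton (x : α × Bool) : (mk [x])⁻¹ = mk [letterInv x] := rfl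

lemma length_lt_of_prefix_append {β : Type*} {P Q A B C : List β} (hP : P <+: C ++ A)
    (hQ : Q <+: C ++ B) (hPQ : ¬P <+: Q) (hQP : ¬Q <+: P) : C.length < P.length := by
  by_contra! h
  have hPC : P <+: C := List.prefix_of_prefix_length_le hP (List.prefix_append C A) h
  exact (List.prefix_or_prefix_of_prefix (hPC.trans (List.prefix_append C B)) hQ).elim hPQ hQP

lemma exists_append_append_of_isReduced {L M : List (α × Bool)} (hL : IsReduced L)
    (hM : IsReduced M) :
    ∃ A B C, L = A ++ C ∧ M = invRev C ++ B ∧ IsReduced (A ++ B) := by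
  induction L using List.reverseRecOn generalizing M with
  | nil => exact ⟨[], M, [], rfl, rfl, hM⟩
  | append_singleton L x ih =>
    by_cases hx : letterInv x ∈ M.head?
    · obtain ⟨M, rfl⟩ := List.head?_eq_some_iff.1 hx
      obtain ⟨A, B, C, rfl, rfl, h⟩ := ih (isReduced_append_iff.1 hL).1 (isReduced_cons_iff.1 hM).1
      exact ⟨A, B, C ++ [x], by simp, by simp [invRev], h⟩
    · refine ⟨L ++ [x], M, [], by simp, rfl, isReduced_append_iff.2 ⟨hL, hM, ?_⟩⟩
      intro y hy z hz hzy
      obtain rfl : x = y := by simpa using hy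
      exact hx (hzy ▸ hz)

variable [DecidableEq α]

lemma toWord_mk_of_isReduced {L : List (α × Bool)} (h : IsReduced L) : (mk L).toWord = L := by
  rw [toWord_mk, h.reduce_eq]

lemma toWord_mk_singleton (x : α × Bool) : (mk [x]).toWord = [x] :=
  toWord_mk_of_isReduced .singleton

lemma exists_toWord_mul (g h : FreeGroup α) :
    ∃ A B C, g.toWord = A ++ C ∧ h.toWord = invRev C ++ B ∧ (g * h).toWord = A ++ B := by
  obtain ⟨A, B, C, hg, hh, hAB⟩ :=
    exists_append_append_of_isReduced (isReduced_toWord (x := g)) (isReduced_toWord (x := h))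
  refine ⟨A, B, C, hg, hh, ?_⟩
  have hgh : g * h = mk (A ++ B) := by
    rw [← mk_toWord (x := g), ← mk_toWord (x := h), hg, hh]
    simp only [← mul_mk, ← inv_mk]
    group
  rw [hgh, toWord_mk_of_isReduced hAB]

lemma exists_mem_head?_toWord_inv {g : FreeGroup α} {x : α × Bool} {L : List (α × Bool)}
    (h : g.toWord = x :: L) : ∃ y, y ∈ g⁻¹.toWord.head? := by
  simp [h, head?_invRev, List.getLast?_cons]

lemma toWord_letter_inv_mul {g : FreeGroup α} {x : α × Bool} {L : List (α × Bool)}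
    (h : g.toWord = x :: L) : ((mk [x])⁻¹ * g).toWord = L := by
  have hL : IsReduced L := (isReduced_cons_iff.1 (h ▸ isReduced_toWord)).1
  have hg : g = mk [x] * mk L := by rw [mul_mk, List.singleton_append, ← h, mk_toWord]
  rw [hg, inv_mul_cancel_left, toWord_mk_of_isReduced hL]

lemma norm_letter_inv_mul {g : FreeGroup α} {x : α × Bool} (h : x ∈ g.toWord.head?) :
    norm ((mk [x])⁻¹ * g) + 1 = norm g := by
  obtain ⟨L, hL⟩ := List.head?_eq_some_iff.1 h
  rw [FreeGroup.norm, FreeGroup.norm, toWord_letter_inv_mul hL, hL, List.length_cons]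

lemma head?_toWord_inv_letter_inv_mul {g : FreeGroup α} {x y : α × Bool} {L : List (α × Bool)}
    (h : g.toWord = x :: y :: L) : ((mk [x])⁻¹ * g)⁻¹.toWord.head? = g⁻¹.toWord.head? := by
  rw [toWord_inv, toWord_inv, toWord_letter_inv_mul h, h, head?_invRev, head?_invRev,
    List.getLast?_cons_cons]

lemma norm_letter_conj_le {g : FreeGroup α} {x : α × Bool} (h : x ∈ g.toWord.head?) :
    norm ((mk [x])⁻¹ * g * mk [x]) ≤ norm g := by
  calc norm ((mk [x])⁻¹ * g * mk [x])
      ≤ norm ((mk [x])⁻¹ * g) + norm (mk [x]) := norm_mul_le _ _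
    _ ≤ norm ((mk [x])⁻¹ * g) + 1 := by gcongr; exact norm_mk_le
    _ = norm g := norm_letter_inv_mul h

lemma norm_letter_conj_lt {g : FreeGroup α} {x : α × Bool} (h : x ∈ g.toWord.head?)
    (h' : x ∈ g⁻¹.toWord.head?) : norm ((mk [x])⁻¹ * g * mk [x]) < norm g := by
  obtain ⟨L, hL⟩ := List.head?_eq_some_iff.1 h
  obtain _ | ⟨y, L⟩ := L
  · rw [toWord_inv, hL] at h'
    exact absurd (Option.mem_some_iff.1 h') (letterInv_ne x)
  · rw [← head?_toWord_inv_letter_inv_mul hL] at h'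
    have hnorm := norm_letter_inv_mul h'
    rw [norm_inv_eq, ← mul_inv_rev, norm_inv_eq] at hnorm
    have := norm_letter_inv_mul h
    omega

lemma toWord_letter_conj {g : FreeGroup α} {x : α × Bool} {L : List (α × Bool)}
    (h : g.toWord = x :: L) (h' : x ∉ g⁻¹.toWord.head?) :
    ((mk [x])⁻¹ * g * mk [x]).toWord = L ++ [x] := by
  have hL : IsReduced (L ++ [x]) := by
    refine isReduced_append_iff.2 ⟨(isReduced_cons_iff.1 (h ▸ isReduced_toWord)).1, .singleton, ?_⟩
    intro y hy z hz hzy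
    obtain rfl : x = z := by simpa using hz
    refine h' ?_
    obtain _ | ⟨w, L⟩ := L
    · simp at hy
    · rw [toWord_inv, h, head?_invRev, List.getLast?_cons_cons, hy, hzy, Option.map_some,
        Option.mem_some_iff]
  have hg : (mk [x])⁻¹ * g = mk L := by rw [← toWord_letter_inv_mul h, mk_toWord]
  rw [hg, mul_mk, toWord_mk_of_isReduced hL]

end Words

section Nielsen

variable {α ι : Type*} [DecidableEq α] {f : FreeGroup ι →* FreeGroup α}
  {P : ι × Bool → List (α × Bool)}

/-- Words `P e` which begin the images of the letters `e`, none of which is a prefix of another,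
and such that `P e` and the inverse of `P e⁻¹` overlap in at most one letter of the image of `e`.
These are the isolated initial segments of a Nielsen reduced family: they guarantee that only
part of `P e⁻¹` cancels in the image of a reduced word, so that `P e` survives. -/
structure IsIsolatedInitialSegments (f : FreeGroup ι →* FreeGroup α)
    (P : ι × Bool → List (α × Bool)) : Prop where
  prefix_toWord : ∀ e, P e <+: (f (mk [e])).toWord
  not_isPrefix : Pairwise fun e e' ↦ ¬P e <+: P e'
  length_add_length_le : ∀ e, (P e).length + (P (letterInv e)).length ≤ norm (f (mk [e])) + 1

lemma prefix_toWord_map_mk_cons (hP : IsIsolatedInitialSegments f P) (l : List (ι × Bool)) :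
    ∀ e, IsReduced (e :: l) →
      P e <+: (f (mk (e :: l))).toWord ∧ (l ≠ [] → 2 ≤ norm (f (mk (e :: l)))) := by
  induction l with
  | nil => exact fun e _ ↦ ⟨hP.prefix_toWord e, fun h ↦ absurd rfl h⟩
  | cons e' l ih =>
    intro e hl
    obtain ⟨hl', he⟩ := isReduced_cons_iff.1 hl
    have hne : letterInv e ≠ e' := fun h ↦ he (h ▸ rfl)
    have hP' := (ih e' hl').1
    have hinv : P (letterInv e) <+: (f (mk [e]))⁻¹.toWord := by
      rw [← map_inv, inv_mk_singleton]
      exact hP.prefix_toWord (letterInv e)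
    obtain ⟨A, B, C, hg, hh, hgh⟩ := exists_toWord_mul (f (mk [e])) (f (mk (e' :: l)))
    rw [← map_mul, mul_mk, List.singleton_append] at hgh
    rw [toWord_inv, hg, invRev_append] at hinv
    rw [hh] at hP'
    have hC := length_lt_of_prefix_append hinv hP' (hP.not_isPrefix hne) (hP.not_isPrefix hne.symm)
    have hC' := length_lt_of_prefix_append hP' hinv (hP.not_isPrefix hne.symm) (hP.not_isPrefix hne)
    have hlen := hP.length_add_length_le e
    have hlen' := hP'.length_le
    have hPe : 0 < (P e).length := List.length_pos_iff.2 fun h ↦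
      hP.not_isPrefix (letterInv_ne e).symm (h ▸ List.nil_prefix)
    have hpre := hP.prefix_toWord e
    simp only [FreeGroup.norm, hgh, hg, List.length_append, invRev_length] at *
    have hPA : P e <+: A :=
      List.prefix_of_prefix_length_le hpre (List.prefix_append _ _) (by omega)
    exact ⟨hPA.trans (List.prefix_append _ _), fun _ ↦ by omega⟩

lemma exists_map_mk_singleton_eq (hP : IsIsolatedInitialSegments f P) {x : α × Bool}
    (hx : mk [x] ∈ f.range) : ∃ e, f (mk [e]) = mk [x] := by
  classical
  obtain ⟨g, hg⟩ := hx
  have hnorm : norm (f g) = 1 := by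
    rw [hg, FreeGroup.norm, toWord_mk_singleton, List.length_singleton]
  have hred := isReduced_toWord (x := g)
  rw [← mk_toWord (x := g)] at hg hnorm
  rcases hl : g.toWord with _ | ⟨e, _ | ⟨e', l⟩⟩ <;> rw [hl] at hg hnorm hred
  · rw [← one_eq_mk, map_one, FreeGroup.norm_one] at hnorm
    exact absurd hnorm zero_ne_one
  · exact ⟨e, hg⟩
  · exact absurd ((prefix_toWord_map_mk_cons hP _ e hred).2 (List.cons_ne_nil _ _)) (by omega)

lemma mk_singleton_eq_of_mem_closure_pair {σ τ : FreeGroup α} {P P' Q Q' : List (α × Bool)}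
    (hP : P <+: σ.toWord) (hP' : P' <+: σ⁻¹.toWord) (hQ : Q <+: τ.toWord)
    (hQ' : Q' <+: τ⁻¹.toWord)
    (hne : [P, P', Q, Q'].Pairwise fun L M ↦ ¬L <+: M ∧ ¬M <+: L)
    (hσ : P.length + P'.length ≤ norm σ + 1) (hτ : Q.length + Q'.length ≤ norm τ + 1)
    {x : α × Bool} (hx : mk [x] ∈ Subgroup.closure {σ, τ}) :
    (mk [x] = σ ∨ mk [x] = σ⁻¹) ∨ mk [x] = τ ∨ mk [x] = τ⁻¹ := by
  simp only [List.pairwise_cons, List.mem_cons, List.not_mem_nil, or_false, forall_eq_or_imp,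
    forall_eq, IsEmpty.forall_iff, implies_true, List.Pairwise.nil, and_true] at hne
  obtain ⟨⟨hPP', hPQ, hPQ'⟩, ⟨hP'Q, hP'Q'⟩, hQQ'⟩ := hne
  have hseg : IsIsolatedInitialSegments (lift fun b : Bool ↦ cond b σ τ)
      fun e ↦ cond e.1 (cond e.2 P P') (cond e.2 Q Q') := by
    refine ⟨?_, ?_, ?_⟩
    · rintro ⟨_ | _, _ | _⟩ <;> simpa [-toWord_inv]
    · rintro ⟨_ | _, _ | _⟩ ⟨_ | _, _ | _⟩ h <;> simp_all
    · rintro ⟨_ | _, _ | _⟩ <;> simpa [add_comm]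
  have hrange : Subgroup.closure {σ, τ} = (lift fun b : Bool ↦ cond b σ τ).range := by
    rw [range_lift_eq_closure, Bool.range_eq, Set.pair_comm]; rfl
  obtain ⟨⟨_ | _, _ | _⟩, he⟩ := exists_map_mk_singleton_eq hseg (hrange ▸ hx) <;>
    simp_all [eq_comm]

end Nielsen

/-! ### Generating pairs of the free group of rank two -/

section Pairs

variable {Γ : Type*} [Group Γ]

lemma not_commute_of_closure_eq_top {a b : Γ} (h : Subgroup.closure {a, b} = ⊤) {x y : Γ}
    (hxy : ¬Commute x y) : ¬Commute a b := by
  intro hab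
  have hcomm : ∀ g ∈ ({a, b} : Set Γ), ∀ k ∈ ({a, b} : Set Γ), g * k = k * g := by
    rintro g (rfl | rfl) k (rfl | rfl)
    exacts [rfl, hab, hab.symm, rfl]
  have := Subgroup.isMulCommutative_closure hcomm
  exact hxy (setLike_mul_comm (s := Subgroup.closure {a, b}) (h ▸ Subgroup.mem_top x)
    (h ▸ Subgroup.mem_top y))

namespace IsSwapInvOf

lemma refl (p : Γ × Γ) : IsSwapInvOf p p :=
  ⟨p.1, p.2, .inl rfl, .inl rfl, .inl rfl⟩

lemma swap (a b : Γ) : IsSwapInvOf (a, b) (b, a) :=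
  ⟨a, b, .inl rfl, .inl rfl, .inr rfl⟩

lemma trans {p q r : Γ × Γ} (hpq : IsSwapInvOf p q) (hqr : IsSwapInvOf q r) :
    IsSwapInvOf p r := by
  obtain ⟨x, y, hx, hy, rfl | rfl⟩ := hpq <;> obtain ⟨z, w, hz, hw, rfl | rfl⟩ := hqr
  · exact ⟨z, w, by aesop, by aesop, .inl rfl⟩
  · exact ⟨z, w, by aesop, by aesop, .inr rfl⟩
  · exact ⟨w, z, by aesop, by aesop, .inr rfl⟩
  · exact ⟨w, z, by aesop, by aesop, .inl rfl⟩

lemma map {Δ : Type*} [Group Δ] (f : Γ →* Δ) {p q : Γ × Γ} (h : IsSwapInvOf p q) :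
    IsSwapInvOf (f p.1, f p.2) (f q.1, f q.2) := by
  obtain ⟨x, y, hx, hy, hq⟩ := h
  exact ⟨f x, f y, by aesop, by aesop, by aesop⟩

lemma of_eq_or_eq_inv {a b x y : Γ} (hab : a ≠ b) (hab' : a ≠ b⁻¹)
    (ha : (a = x ∨ a = x⁻¹) ∨ a = y ∨ a = y⁻¹) (hb : (b = x ∨ b = x⁻¹) ∨ b = y ∨ b = y⁻¹) :
    IsSwapInvOf (a, b) (x, y) := by
  have flip {c z : Γ} (h : c = z ∨ c = z⁻¹) : z = c ∨ z = c⁻¹ :=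
    h.imp Eq.symm fun h ↦ by rw [h, inv_inv]
  have distinct {z : Γ} (ha : a = z ∨ a = z⁻¹) (hb : b = z ∨ b = z⁻¹) : False := by
    rcases ha with rfl | rfl <;> rcases hb with rfl | rfl <;> simp at hab hab'
  rcases ha with ha | ha <;> rcases hb with hb | hb
  · exact (distinct ha hb).elim
  · exact ⟨x, y, flip ha, flip hb, .inl rfl⟩
  · exact ⟨y, x, flip ha, flip hb, .inr rfl⟩
  · exact (distinct ha hb).elim

lemma closure_le {p q : Γ × Γ} (h : IsSwapInvOf p q) :
    Subgroup.closure {p.1, p.2} ≤ Subgroup.closure {q.1, q.2} := by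
  obtain ⟨x, y, hx, hy, hq⟩ := h
  have hxq : x ∈ Subgroup.closure {q.1, q.2} := Subgroup.subset_closure (by aesop)
  have hyq : y ∈ Subgroup.closure {q.1, q.2} := Subgroup.subset_closure (by aesop)
  rw [Subgroup.closure_le, Set.insert_subset_iff, Set.singleton_subset_iff]
  exact ⟨by aesop, by aesop⟩

end IsSwapInvOf

/-- Up to a common conjugation of its entries, the pair `q` arises from the pair `p` by (possibly)
interchanging the two entries and (possibly) replacing either entry by its inverse. -/
def IsConjSwapInvOf (p q : Γ × Γ) : Prop :=
  ∃ u x y : Γ, IsSwapInvOf p (x, y) ∧ q = (u * x * u⁻¹, u * y * u⁻¹)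

lemma IsSwapInvOf.isConjSwapInvOf {p q : Γ × Γ} (h : IsSwapInvOf p q) : IsConjSwapInvOf p q :=
  ⟨1, q.1, q.2, h, by simp⟩

namespace IsConjSwapInvOf

lemma conj (u a b : Γ) : IsConjSwapInvOf (a, b) (u * a * u⁻¹, u * b * u⁻¹) :=
  ⟨u, a, b, .refl _, rfl⟩

lemma trans {p q r : Γ × Γ} (hpq : IsConjSwapInvOf p q) (hqr : IsConjSwapInvOf q r) :
    IsConjSwapInvOf p r := by
  obtain ⟨u, x, y, hp, rfl⟩ := hpq
  obtain ⟨v, z, w, hq, rfl⟩ := hqr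
  have hxy := hq.map (MulAut.conj u⁻¹).toMonoidHom
  refine ⟨v * u, u⁻¹ * z * u, u⁻¹ * w * u, hp.trans ?_, ?_⟩
  · simpa [mul_assoc] using hxy
  · ext <;> group

lemma closure_eq_top {p q : Γ × Γ} (h : IsConjSwapInvOf p q)
    (hp : Subgroup.closure {p.1, p.2} = ⊤) : Subgroup.closure {q.1, q.2} = ⊤ := by
  obtain ⟨u, x, y, hxy, rfl⟩ := h
  have hxy' : Subgroup.closure {x, y} = ⊤ := top_le_iff.1 (hp ▸ hxy.closure_le)
  have := congrArg (Subgroup.map (MulAut.conj u).toMonoidHom) hxy'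
  rw [MonoidHom.map_closure, Set.image_pair,
    Subgroup.map_top_of_surjective _ (MulAut.conj u).surjective] at this
  exact this

end IsConjSwapInvOf

end Pairs

section Turns

variable {α : Type*} [DecidableEq α]

/-- The first letters of `σ` and of `σ⁻¹`, i.e. the edges of the Cayley tree by which one leaves
the identity on the way to `σ` and to `σ⁻¹`. -/
def initialLetters (σ : FreeGroup α) : Set (α × Bool) :=
  {x | x ∈ σ.toWord.head? ∨ x ∈ σ⁻¹.toWord.head?}

/-- `σ` and `τ` have the same first letter `x`, their inverses have the same first letter `y`, and
`x ≠ y`. Then `σ` and `τ` are cyclically reduced and their axes in the Cayley tree have the turn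
at the identity between the edges `y` and `x` in common, traversed in the same direction. -/
def SharesTurn (σ τ : FreeGroup α) : Prop :=
  ∃ x y, x ≠ y ∧ (x ∈ σ.toWord.head? ∧ x ∈ τ.toWord.head?) ∧
    y ∈ σ⁻¹.toWord.head? ∧ y ∈ τ⁻¹.toWord.head?

lemma exists_incomparable_prefixes {σ : FreeGroup α} (hσ : σ ≠ 1) :
    ∃ P P', P <+: σ.toWord ∧ P' <+: σ⁻¹.toWord ∧ (¬P <+: P' ∧ ¬P' <+: P) ∧
      P.length + P'.length ≤ norm σ + 1 := by
  obtain ⟨v, t, hvt, ht⟩ : ∃ v t, σ.toWord = v ++ t ++ invRev v ∧ IsCyclicallyReduced t :=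
    ⟨_, _, (reduceCyclically.conj_conjugator_reduceCyclically σ.toWord).symm,
      reduceCyclically.isCyclicallyReduced isReduced_toWord⟩
  obtain rfl | ⟨t, z, rfl⟩ := t.eq_nil_or_concat'
  · refine absurd ?_ hσ
    rw [← mk_toWord (x := σ), hvt, List.append_nil, ← mul_mk, ← inv_mk, mul_inv_cancel]
  obtain ⟨y, hy⟩ : ∃ y, y ∈ (t ++ [z]).head? := by cases t <;> simp
  have hyz : y ≠ letterInv z :=
    ne_letterInv_iff.2 ((isCyclicallyReduced_iff.1 ht).2 z (by simp) y hy)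
  obtain ⟨r, hr⟩ := List.head?_eq_some_iff.1 hy
  refine ⟨v ++ [y], v ++ [letterInv z], ?_, ?_, ?_, ?_⟩
  · exact ⟨r ++ invRev v, by rw [hvt, hr]; simp⟩
  · exact ⟨invRev t ++ invRev v, by
      rw [toWord_inv, hvt, invRev_append, invRev_append, invRev_append, invRev_invRev]
      simp [invRev]⟩
  · simp only [List.prefix_append_right_inj]
    constructor <;> refine not_isPrefix_of_head?_ne (List.cons_ne_nil _ _) ?_
    · simpa using hyz
    · simpa using hyz.symm
  · rw [FreeGroup.norm, hvt]
    simp only [List.length_append, invRev_length, List.length_singleton]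
    omega

lemma mk_singleton_eq_of_disjoint_initialLetters {σ τ : FreeGroup α} (hσ : σ ≠ 1) (hτ : τ ≠ 1)
    (hdisj : Disjoint (initialLetters σ) (initialLetters τ)) {x : α × Bool}
    (hx : mk [x] ∈ Subgroup.closure {σ, τ}) :
    (mk [x] = σ ∨ mk [x] = σ⁻¹) ∨ mk [x] = τ ∨ mk [x] = τ⁻¹ := by
  obtain ⟨P, P', hP, hP', hPP', hPlen⟩ := exists_incomparable_prefixes hσ
  obtain ⟨Q, Q', hQ, hQ', hQQ', hQlen⟩ := exists_incomparable_prefixes hτ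
  have incomparable {L M : List (α × Bool)} (hL0 : L ≠ []) (hM0 : M ≠ [])
      (hL : L <+: σ.toWord ∨ L <+: σ⁻¹.toWord) (hM : M <+: τ.toWord ∨ M <+: τ⁻¹.toWord) :
      ¬L <+: M ∧ ¬M <+: L := by
    obtain ⟨y, L, rfl⟩ := List.exists_cons_of_ne_nil hL0
    obtain ⟨z, M, rfl⟩ := List.exists_cons_of_ne_nil hM0
    have hy : y ∈ initialLetters σ :=
      hL.imp (head?_eq_of_isPrefix · hL0) (head?_eq_of_isPrefix · hL0)
    have hz : z ∈ initialLetters τ :=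
      hM.imp (head?_eq_of_isPrefix · hM0) (head?_eq_of_isPrefix · hM0)
    have hyz : y ≠ z := hdisj.ne_of_mem hy hz
    exact ⟨not_isPrefix_of_head?_ne hL0 (by simpa using hyz),
      not_isPrefix_of_head?_ne hM0 (by simpa using hyz.symm)⟩
  have ne_nil {L M : List (α × Bool)} (h : ¬L <+: M) : L ≠ [] := by
    rintro rfl
    exact h List.nil_prefix
  refine mk_singleton_eq_of_mem_closure_pair hP hP' hQ hQ' ?_ hPlen hQlen hx
  simp only [List.pairwise_cons, List.mem_cons, List.not_mem_nil, or_false, forall_eq_or_imp,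
    forall_eq, IsEmpty.forall_iff, implies_true, List.Pairwise.nil, and_true]
  exact ⟨⟨hPP', incomparable (ne_nil hPP'.1) (ne_nil hQQ'.1) (.inl hP) (.inl hQ),
    incomparable (ne_nil hPP'.1) (ne_nil hQQ'.2) (.inl hP) (.inr hQ')⟩,
    ⟨incomparable (ne_nil hPP'.2) (ne_nil hQQ'.1) (.inr hP') (.inl hQ),
    incomparable (ne_nil hPP'.2) (ne_nil hQQ'.2) (.inr hP') (.inr hQ')⟩, hQQ'⟩

lemma exists_head?_of_mem_initialLetters {ρ : FreeGroup α} {x : α × Bool}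
    (hx : x ∈ initialLetters ρ) :
    ∃ σ, (σ = ρ ∨ σ = ρ⁻¹) ∧ norm σ = norm ρ ∧ x ∈ σ.toWord.head? := by
  rcases hx with hx | hx
  · exact ⟨ρ, .inl rfl, rfl, hx⟩
  · exact ⟨ρ⁻¹, .inr rfl, norm_inv_eq, hx⟩

lemma two_le_norm_of_toWord_eq {g : FreeGroup α} {x y : α × Bool} {l : List (α × Bool)}
    (h : g.toWord = x :: y :: l) : 2 ≤ norm g := by
  rw [FreeGroup.norm, h, List.length_cons, List.length_cons]
  omega

-- `[x, y]`, `[u]`, `[x, z]` and `[w]` isolate `σ` and `τ`, which thus freely generate a subgroup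
-- whose only elements of length one are those among `σ`, `τ` and their inverses: there are none.
lemma closure_pair_ne_top_of_branching {σ τ : FreeGroup α} {x y z u w : α × Bool}
    {s t : List (α × Bool)} (hσ : σ.toWord = x :: y :: s)
    (hτ : τ.toWord = x :: z :: t) (hu : u ∈ σ⁻¹.toWord.head?) (hw : w ∈ τ⁻¹.toWord.head?)
    (hyz : y ≠ z) (huw : u ≠ w) (hux : u ≠ x) (hwx : w ≠ x) :
    Subgroup.closure {σ, τ} ≠ ⊤ := by
  intro hgen
  have hP : [x, y] <+: σ.toWord := ⟨s, by rw [hσ]; rfl⟩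
  have hQ : [x, z] <+: τ.toWord := ⟨t, by rw [hτ]; rfl⟩
  have hP' : [u] <+: σ⁻¹.toWord := by
    obtain ⟨r, hr⟩ := List.head?_eq_some_iff.1 hu
    exact ⟨r, hr.symm⟩
  have hQ' : [w] <+: τ⁻¹.toWord := by
    obtain ⟨r, hr⟩ := List.head?_eq_some_iff.1 hw
    exact ⟨r, hr.symm⟩
  have hσ2 : 2 ≤ norm σ := two_le_norm_of_toWord_eq hσ
  have hτ2 : 2 ≤ norm τ := two_le_norm_of_toWord_eq hτ
  have hne : [[x, y], [u], [x, z], [w]].Pairwise fun L M ↦ ¬L <+: M ∧ ¬M <+: L := by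
    simp [hux, hux.symm, hwx, hwx.symm, hyz, hyz.symm, huw, huw.symm]
  have hx : norm (mk [x]) = 1 := congrArg List.length (toWord_mk_singleton x)
  rcases mk_singleton_eq_of_mem_closure_pair hP hP' hQ hQ' hne (by simpa) (by simpa) (x := x)
    (hgen ▸ Subgroup.mem_top _) with (h | h) | h | h <;>
  · replace h := congrArg FreeGroup.norm h
    simp only [hx, norm_inv_eq] at h
    omega

-- Conjugating by `x` moves the base point to the vertex reached by `x`, where both axes arrive
-- through `x⁻¹`; if they also continued along the same edge, they would share this turn.
lemma head?_toWord_letter_conj_ne {σ τ : FreeGroup α} {x : α × Bool} {s t : List (α × Bool)}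
    (hσ : σ.toWord = x :: s) (hτ : τ.toWord = x :: t)
    (hσ' : x ∉ σ⁻¹.toWord.head?) (hτ' : x ∉ τ⁻¹.toWord.head?)
    (hturn : ¬SharesTurn ((mk [x])⁻¹ * σ * mk [x]) ((mk [x])⁻¹ * τ * mk [x])) :
    (s ++ [x]).head? ≠ (t ++ [x]).head? := by
  intro h
  obtain ⟨z, hz⟩ : ∃ z, z ∈ (s ++ [x]).head? := by cases s <;> simp
  have hred : FreeGroup.IsReduced (x :: s) := hσ ▸ isReduced_toWord
  have hzx : z ≠ letterInv x := by
    rintro rfl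
    obtain _ | ⟨y, s⟩ := s
    · exact letterInv_ne x (Option.mem_some_iff.1 hz).symm
    · exact (isReduced_cons_iff.1 hred).2 hz
  refine hturn ⟨z, letterInv x, hzx, ?_, ?_⟩
  · rw [toWord_letter_conj hσ hσ', toWord_letter_conj hτ hτ', ← h, and_self]
    exact hz
  · rw [toWord_inv, toWord_inv, toWord_letter_conj hσ hσ', toWord_letter_conj hτ hτ']
    simp [head?_invRev]

end Turns

section RankTwo

variable {σ τ : FreeGroup (Fin 2)}

lemma not_commute_of_closure_eq_top_freeGroup (h : Subgroup.closure {σ, τ} = ⊤) :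
    ¬Commute σ τ :=
  not_commute_of_closure_eq_top h (x := of 0) (y := of 1) (by unfold Commute SemiconjBy; decide)

lemma isSwapInvOf_generators_of_disjoint_initialLetters (hgen : Subgroup.closure {σ, τ} = ⊤)
    (hdisj : Disjoint (initialLetters σ) (initialLetters τ)) :
    IsSwapInvOf (of 0, of 1) (σ, τ) := by
  have hcomm := not_commute_of_closure_eq_top_freeGroup hgen
  have hσ : σ ≠ 1 := by rintro rfl; exact hcomm (.one_left _)
  have hτ : τ ≠ 1 := by rintro rfl; exact hcomm (.one_right _)
  have hletter (i : Fin 2) := mk_singleton_eq_of_disjoint_initialLetters hσ hτ hdisj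
    (x := (i, true)) (hgen ▸ Subgroup.mem_top _)
  exact .of_eq_or_eq_inv (by decide) (by decide) (hletter 0) (hletter 1)

/-- The normal form of the pairs of parabolic generators: up to conjugation, interchange and
inversion, `p` is a pair `(a, b)` or `(a, ab)`, where `(a, b)` are the free generators up to
interchange and inversion. -/
def IsStandardPair (p : FreeGroup (Fin 2) × FreeGroup (Fin 2)) : Prop :=
  ∃ a b, IsSwapInvOf (of 0, of 1) (a, b) ∧
    (IsConjSwapInvOf p (a, b) ∨ IsConjSwapInvOf p (a, a * b))

lemma IsConjSwapInvOf.isStandardPair {p q : FreeGroup (Fin 2) × FreeGroup (Fin 2)}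
    (h : IsConjSwapInvOf p q) : IsStandardPair q → IsStandardPair p
  | ⟨a, b, hab, hq⟩ => ⟨a, b, hab, hq.imp h.trans h.trans⟩

lemma isStandardPair_singleton {x : Fin 2 × Bool} {t : List (Fin 2 × Bool)}
    (hτ : τ.toWord = x :: t) (hgen : Subgroup.closure {mk [x], τ} = ⊤) (ht : x ∉ (t ++ [x]).head?)
    (hx : x ∉ τ⁻¹.toWord.head?) (hx' : letterInv x ∉ τ⁻¹.toWord.head?) :
    IsStandardPair (mk [x], τ) := by
  have hρ : ((mk [x])⁻¹ * τ).toWord = t := toWord_letter_inv_mul hτ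
  obtain _ | ⟨y, t⟩ := t
  · simp at ht
  have hτ' := head?_toWord_inv_letter_inv_mul hτ
  have hred := isReduced_cons_iff.1 (hτ ▸ isReduced_toWord)
  set ρ := (mk [x])⁻¹ * τ with hρτ
  have hτρ : τ = mk [x] * ρ := by rw [hρτ, mul_inv_cancel_left]
  have hgen' : Subgroup.closure {mk [x], ρ} = ⊤ := by
    rw [eq_top_iff, ← hgen, Subgroup.closure_le, Set.insert_subset_iff, Set.singleton_subset_iff,
      hτρ]
    have hmem : mk [x] ∈ Subgroup.closure {mk [x], ρ} := Subgroup.subset_closure (by simp)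
    exact ⟨hmem, mul_mem hmem (Subgroup.subset_closure (by simp))⟩
  have hdisj : Disjoint (initialLetters (mk [x])) (initialLetters ρ) := by
    refine Set.disjoint_left.2 ?_
    simp only [initialLetters, Set.mem_ofPred_eq, inv_mk_singleton, toWord_mk_singleton, hρ, hτ']
    rintro z (hz | hz) <;> obtain rfl := Option.mem_some_iff.1 hz
    · exact not_or_intro ht hx
    · exact not_or_intro hred.2 hx'
  exact ⟨mk [x], ρ, isSwapInvOf_generators_of_disjoint_initialLetters hgen' hdisj,
    .inr (hτρ ▸ (IsSwapInvOf.refl _).isConjSwapInvOf)⟩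

lemma isStandardPair_of_head?_eq {x : Fin 2 × Bool} (hgen : Subgroup.closure {σ, τ} = ⊤)
    (hσ : x ∈ σ.toWord.head?) (hτ : x ∈ τ.toWord.head?) (hσ' : x ∉ σ⁻¹.toWord.head?)
    (hτ' : x ∉ τ⁻¹.toWord.head?) (hturn : ¬SharesTurn σ τ)
    (hturn' : ¬SharesTurn ((mk [x])⁻¹ * σ * mk [x]) ((mk [x])⁻¹ * τ * mk [x])) :
    IsStandardPair (σ, τ) := by
  obtain ⟨s, hs⟩ := List.head?_eq_some_iff.1 hσ
  obtain ⟨t, ht⟩ := List.head?_eq_some_iff.1 hτ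
  have hhead := head?_toWord_letter_conj_ne hs ht hσ' hτ' hturn'
  obtain ⟨u, hu⟩ := exists_mem_head?_toWord_inv hs
  obtain ⟨w, hw⟩ := exists_mem_head?_toWord_inv ht
  have hux : u ≠ x := fun h ↦ hσ' (h ▸ hu)
  have hwx : w ≠ x := fun h ↦ hτ' (h ▸ hw)
  have huw : u ≠ w := fun h ↦ hturn ⟨x, u, hux.symm, ⟨hσ, hτ⟩, hu, h ▸ hw⟩
  have letterInv_notMem {g k : FreeGroup (Fin 2)} {a b : Fin 2 × Bool} (hg : g.toWord = [x])
      (ha : a ∈ g⁻¹.toWord.head?) (hb : b ∈ k⁻¹.toWord.head?) (hab : a ≠ b) :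
      letterInv x ∉ k⁻¹.toWord.head? := by
    rw [toWord_inv, hg] at ha
    exact fun h ↦ hab ((Option.mem_some_iff.1 ha).symm.trans (Option.mem_unique h hb))
  rcases s with _ | ⟨y, s⟩
  · obtain rfl : mk [x] = σ := by rw [← hs, mk_toWord]
    exact isStandardPair_singleton ht hgen hhead.symm hτ' (letterInv_notMem hs hu hw huw)
  rcases t with _ | ⟨z, t⟩
  · obtain rfl : mk [x] = τ := by rw [← ht, mk_toWord]
    exact (IsSwapInvOf.swap _ _).isConjSwapInvOf.isStandardPair (isStandardPair_singleton hs
      (Set.pair_comm _ _ ▸ hgen) hhead hσ' (letterInv_notMem ht hw hu huw.symm))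
  have hyz : y ≠ z := by simpa using hhead
  exact absurd hgen (closure_pair_ne_top_of_branching hs ht hu hw hyz huw hux hwx)

theorem isStandardPair_of_not_sharesTurn {p : FreeGroup (Fin 2) × FreeGroup (Fin 2)}
    (hgen : Subgroup.closure {p.1, p.2} = ⊤)
    (hturn : ∀ q, IsConjSwapInvOf p q → ¬SharesTurn q.1 q.2) : IsStandardPair p := by
  induction hn : norm p.1 + norm p.2 using Nat.strong_induction_on generalizing p with
  | h n ih =>
  by_cases hdisj : Disjoint (initialLetters p.1) (initialLetters p.2)
  · exact ⟨p.1, p.2, isSwapInvOf_generators_of_disjoint_initialLetters hgen hdisj,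
      .inl (IsSwapInvOf.refl p).isConjSwapInvOf⟩
  obtain ⟨x, hx₁, hx₂⟩ := Set.not_disjoint_iff.1 hdisj
  obtain ⟨σ, τ, hpq, hnorm, hσ, hτ⟩ : ∃ σ τ, IsSwapInvOf p (σ, τ) ∧
      norm σ + norm τ = norm p.1 + norm p.2 ∧ x ∈ σ.toWord.head? ∧ x ∈ τ.toWord.head? := by
    obtain ⟨σ, hpσ, hσ, hxσ⟩ := exists_head?_of_mem_initialLetters hx₁
    obtain ⟨τ, hpτ, hτ, hxτ⟩ := exists_head?_of_mem_initialLetters hx₂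
    exact ⟨σ, τ, ⟨σ, τ, hpσ, hpτ, .inl rfl⟩, by rw [hσ, hτ], hxσ, hxτ⟩
  have hq := hpq.isConjSwapInvOf
  refine hq.isStandardPair ?_
  have hconj := IsConjSwapInvOf.conj (mk [x])⁻¹ σ τ
  rw [inv_inv] at hconj
  have hgen' := hq.closure_eq_top hgen
  have descend (h : x ∈ σ⁻¹.toWord.head? ∨ x ∈ τ⁻¹.toWord.head?) : IsStandardPair (σ, τ) := by
    refine hconj.isStandardPair (ih _ ?_ (hconj.closure_eq_top hgen')
      (fun q h ↦ hturn q (hq.trans (hconj.trans h))) rfl)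
    rw [← hn, ← hnorm]
    rcases h with h | h
    · exact add_lt_add_of_lt_of_le (norm_letter_conj_lt hσ h) (norm_letter_conj_le hτ)
    · exact add_lt_add_of_le_of_lt (norm_letter_conj_le hσ) (norm_letter_conj_lt hτ h)
  by_cases h : x ∈ σ⁻¹.toWord.head? ∨ x ∈ τ⁻¹.toWord.head?
  · exact descend h
  · obtain ⟨hσ', hτ'⟩ := not_or.1 h
    exact isStandardPair_of_head?_eq hgen' hσ hτ hσ' hτ' (hturn _ hq)
      (hturn _ (hq.trans hconj))

end RankTwo

/-! ### Ping-pong with tangent discs -/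

lemma exists_ne_letter {ι : Type*} [Nontrivial ι] (x y : ι × Bool) : ∃ z, x ≠ z ∧ y ≠ z := by
  obtain ⟨i, hi⟩ := exists_ne x.1
  exact ⟨(i, !y.2), fun h ↦ hi (congrArg Prod.fst h).symm,
    fun h ↦ Bool.not_ne_self _ (congrArg Prod.snd h).symm⟩

/-- The circle attached to a letter: `C' i` for the generator `g i` and `C i` for its inverse. Thus
a letter maps the exterior of the circle of its inverse onto the interior of its own circle. -/
def letterCircle {ι : Type*} (C C' : ι → OrientedCircle) (x : ι × Bool) : OrientedCircle :=
  cond x.2 (C' x.1) (C x.1)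

namespace IsClassicalTSchottkyConfiguration

variable {n : ℕ} {C C' : Fin n → OrientedCircle} {g : Fin n → Mobius} {x y : Fin n × Bool}
  {w : FreeGroup (Fin n)} {z : OnePoint ℂ}

lemma disjoint_letterCircle (h : IsClassicalTSchottkyConfiguration C C' g) (hxy : x ≠ y) :
    Disjoint (letterCircle C C' x).interior (letterCircle C C' y).interior := by
  obtain ⟨i, _ | _⟩ := x <;> obtain ⟨j, _ | _⟩ := y
  · exact h.disjoint_interiors (i := .inl i) (j := .inl j) (by simpa using hxy)
  · exact h.disjoint_interiors (i := .inl i) (j := .inr j) (by simp)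
  · exact h.disjoint_interiors (i := .inr i) (j := .inl j) (by simp)
  · exact h.disjoint_interiors (i := .inr i) (j := .inr j) (by simpa using hxy)

lemma notMem_interior_of_ne (h : IsClassicalTSchottkyConfiguration C C' g) (hxy : x ≠ y)
    (hz : z ∉ (letterCircle C C' x).exterior) : z ∉ (letterCircle C C' y).interior := fun hz' ↦
  hz (OrientedCircle.interior_subset_exterior (h.disjoint_letterCircle hxy) hz')

lemma letter_smul_notMem_exterior (h : IsClassicalTSchottkyConfiguration C C' g)
    (hz : z ∉ (letterCircle C C' (letterInv x)).interior) :
    lift g (FreeGroup.mk [x]) • z ∉ (letterCircle C C' x).exterior := by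
  obtain ⟨i, _ | _⟩ := x
  · intro hz'
    refine hz (?_ : z ∈ (C' i).interior)
    rw [← smul_inv_smul (g i) z, OrientedCircle.smul_mem_interior_iff (h.image_exterior i)]
    simpa [lift_mk, letterCircle] using hz'
  · intro hz'
    refine hz ((OrientedCircle.smul_mem_exterior_iff (h.image_exterior i)).1 ?_)
    simpa [lift_mk, letterCircle] using hz'

lemma smul_notMem_exterior (h : IsClassicalTSchottkyConfiguration C C' g)
    (hx : x ∈ w.toWord.head?)
    (hz : ∀ y ∈ w⁻¹.toWord.head?, z ∉ (letterCircle C C' y).interior) :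
    lift g w • z ∉ (letterCircle C C' x).exterior := by
  obtain ⟨l, hl⟩ := List.head?_eq_some_iff.1 hx
  clear hx
  induction l generalizing w x with
  | nil =>
    obtain rfl : FreeGroup.mk [x] = w := by rw [← hl, mk_toWord]
    exact h.letter_smul_notMem_exterior (hz _ (by rw [toWord_inv, hl]; rfl))
  | cons y l ih =>
    have hred : FreeGroup.IsReduced (x :: y :: l) := hl ▸ isReduced_toWord
    have hxy : y ≠ letterInv x := fun hyx ↦ (isReduced_cons_iff.1 hred).2 (congrArg some hyx)
    rw [← head?_toWord_inv_letter_inv_mul hl] at hz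
    rw [← mul_inv_cancel_left (FreeGroup.mk [x]) w, map_mul, mul_smul]
    exact h.letter_smul_notMem_exterior
      (h.notMem_interior_of_ne hxy (ih hz (toWord_letter_inv_mul hl)))

lemma lift_injective [Nontrivial (Fin n)] (h : IsClassicalTSchottkyConfiguration C C' g) :
    Function.Injective (lift g) := by
  refine (injective_iff_map_eq_one _).2 fun w hw ↦ ?_
  by_contra hw1
  obtain ⟨x, l, hl⟩ := List.exists_cons_of_ne_nil (mt toWord_eq_nil_iff.1 hw1)
  obtain ⟨y, hy⟩ := exists_mem_head?_toWord_inv hl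
  obtain ⟨t, hxt, hyt⟩ := exists_ne_letter x y
  obtain ⟨z, hz⟩ := (letterCircle C C' t).interior_nonempty
  have hzy : ∀ y ∈ w⁻¹.toWord.head?, z ∉ (letterCircle C C' y).interior := by
    rintro _ hy'
    obtain rfl := Option.mem_unique hy hy'
    exact h.notMem_interior_of_ne hyt.symm (OrientedCircle.notMem_exterior_of_mem_interior hz)
  refine h.smul_notMem_exterior (by rw [hl]; rfl) hzy (x := x) ?_
  rw [hw, one_smul]
  exact OrientedCircle.interior_subset_exterior (h.disjoint_letterCircle hxt) hz

lemma notMem_exterior_of_smul_eq_self (h : IsClassicalTSchottkyConfiguration C C' g)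
    (hw : (lift g w).IsParabolic) (hz : lift g w • z = z) (hx : x ∈ w.toWord.head?)
    (hx' : x ∉ w⁻¹.toWord.head?) : z ∉ (letterCircle C C' x).exterior := by
  obtain ⟨y, hy⟩ := (letterCircle C C' x).interior_nonempty
  refine hw.notMem_exterior_of_forall_pow hz (z := y) fun k ↦ ?_
  induction k with
  | zero =>
    rw [pow_zero, one_smul]
    exact OrientedCircle.notMem_exterior_of_mem_interior hy
  | succ k ih =>
    rw [pow_succ', mul_smul]
    exact h.smul_notMem_exterior hx fun e he ↦
      h.notMem_interior_of_ne (ne_of_mem_of_not_mem he hx').symm ih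

lemma not_sharesTurn [Nontrivial (Fin n)] (h : IsClassicalTSchottkyConfiguration C C' g)
    {σ τ : FreeGroup (Fin n)} (hσ : (lift g σ).IsParabolic) (hτ : (lift g τ).IsParabolic)
    (hcomm : ¬Commute σ τ) : ¬SharesTurn σ τ := by
  rintro ⟨x, y, hxy, ⟨hxσ, hxτ⟩, hyσ, hyτ⟩
  obtain ⟨p, hp⟩ := hσ.exists_smul_eq_self
  obtain ⟨q, hq⟩ := hτ.exists_smul_eq_self
  have tangency {ρ : FreeGroup (Fin n)} {z : OnePoint ℂ} (hρ : (lift g ρ).IsParabolic)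
      (hz : lift g ρ • z = z) (hx : x ∈ ρ.toWord.head?) (hy : y ∈ ρ⁻¹.toWord.head?) :
      z ∉ (letterCircle C C' x).exterior ∧ z ∉ (letterCircle C C' y).exterior := by
    have hz' : lift g ρ⁻¹ • z = z := by rw [map_inv, inv_smul_eq_iff, hz]
    refine ⟨h.notMem_exterior_of_smul_eq_self hρ hz hx fun hx' ↦ hxy (Option.mem_unique hx' hy),
      h.notMem_exterior_of_smul_eq_self (map_inv (lift g) ρ ▸ hρ.inv) hz' hy fun hy' ↦ ?_⟩
    exact hxy (Option.mem_unique hx (inv_inv ρ ▸ hy'))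
  obtain ⟨t, hxt, hyt⟩ := exists_ne_letter x y
  obtain ⟨hpx, hpy⟩ := tangency hσ hp hxσ hyσ
  obtain ⟨hqx, hqy⟩ := tangency hτ hq hxτ hyτ
  obtain rfl : p = q := OrientedCircle.eq_of_notMem_exterior (h.disjoint_letterCircle hxy)
    (h.disjoint_letterCircle hxt) (h.disjoint_letterCircle hyt) hpx hpy hqx hqy
  exact hcomm (Commute.of_map h.lift_injective (hσ.commute hτ hp hq))

end IsClassicalTSchottkyConfiguration

lemma IsConjSwapInvOf.isParabolic {Γ : Type*} [Group Γ] {f : Γ →* Mobius} {p q : Γ × Γ}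
    (h : IsConjSwapInvOf p q) (hp₁ : (f p.1).IsParabolic) (hp₂ : (f p.2).IsParabolic) :
    (f q.1).IsParabolic ∧ (f q.2).IsParabolic := by
  obtain ⟨u, x, y, ⟨x', y', hx, hy, hxy⟩, rfl⟩ := h
  have hx' : (f x').IsParabolic := by
    rcases hx with rfl | rfl
    exacts [hp₁, map_inv f p.1 ▸ hp₁.inv]
  have hy' : (f y').IsParabolic := by
    rcases hy with rfl | rfl
    exacts [hp₂, map_inv f p.2 ▸ hp₂.inv]
  simp only [map_mul, map_inv]
  rcases hxy with hxy | hxy <;> obtain ⟨rfl, rfl⟩ := Prod.ext_iff.1 hxy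
  exacts [⟨hx'.conj _, hy'.conj _⟩, ⟨hy'.conj _, hx'.conj _⟩]

theorem theorem6p5 (G : Subgroup Mobius) (A B S T : Mobius)
    (hAB : IsMarkedClassicalTSchottky G ![A, B])
    (hS : S.IsParabolic) (hT : T.IsParabolic)
    (hST : Subgroup.closure {S, T} = G) :
    ∃ A' B' S' T' : Mobius, ∃ h ∈ G,
      IsSwapInvOf (A, B) (A', B') ∧ IsSwapInvOf (S, T) (S', T') ∧
      ((h * S' * h⁻¹ = A' ∧ h * T' * h⁻¹ = B') ∨
        (h * S' * h⁻¹ = A' ∧ h * T' * h⁻¹ = A' * B')) := by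
  obtain ⟨hG, C, C', hC⟩ := hAB
  have hrange : (lift ![A, B]).range = G := by rw [range_lift_eq_closure, hG]
  obtain ⟨σ, rfl⟩ : S ∈ (lift ![A, B]).range :=
    hrange ▸ hST ▸ Subgroup.subset_closure (Set.mem_insert S _)
  obtain ⟨τ, rfl⟩ : T ∈ (lift ![A, B]).range :=
    hrange ▸ hST ▸ Subgroup.subset_closure (Set.mem_insert_of_mem _ rfl)
  have hgen : Subgroup.closure {σ, τ} = ⊤ := by
    apply Subgroup.map_injective hC.lift_injective
    rw [MonoidHom.map_closure, Set.image_pair, hST, ← MonoidHom.range_eq_map, hrange]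
  have hturn (q) (hq : IsConjSwapInvOf (σ, τ) q) : ¬SharesTurn q.1 q.2 := by
    obtain ⟨hq₁, hq₂⟩ := hq.isParabolic hS hT
    exact hC.not_sharesTurn hq₁ hq₂ <|
      not_commute_of_closure_eq_top_freeGroup (hq.closure_eq_top hgen)
  obtain ⟨a, b, hab, hστ⟩ := isStandardPair_of_not_sharesTurn (p := (σ, τ)) hgen hturn
  have hab' : IsSwapInvOf (A, B) (lift ![A, B] a, lift ![A, B] b) := by
    simpa using hab.map (lift ![A, B])
  rcases hστ with ⟨u, s, t, hst, h⟩ | ⟨u, s, t, hst, h⟩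
  all_goals
    refine ⟨_, _, _, _, lift ![A, B] u, hrange ▸ ⟨u, rfl⟩, hab', hst.map (lift ![A, B]), ?_⟩
    obtain ⟨ha, hb⟩ := Prod.mk.inj h
    simp only [← map_mul, ← map_inv, ← ha, ← hb, and_self, true_and, true_or, or_true]
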